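/- Let $m,n\ge 1$ and let $A,B\in\mathbb{R}_+^{m\times n}$ be a WN-pair: $n\ge m$, $B$ has no zero row, and each column of $B$ has exactly one positive entry. For a vector $x\in\mathbb{R}^n_+\setminus\{0\}$ put $$r(A,B,x)=\inf\{t\ge 0:\ Ax\le tBx\}\in[0,\infty],\qquad \hat\rho(A,B)=\inf\{r(A,B,x):\ x\in\mathbb{R}^n_+\setminus\{0\}\}.$$ A vector $y\in\mathbb{R}^n_+\setminus\{0\}$ is weakly optimal if $r(A,B,y)=\hat\rho(A,B)$; it is minimal weakly optimal if, in addition, no weakly optimal vector has support strictly contained in $\operatorname{supp}y$. It is a weak GPF-eigenvector if $\hat\rho(A,B)<\infty$ and $Ay=\hat\rho(A,B)By$. Let $\Pi_n$ be the set of probability vectors in $\mathbb{R}^n$, write $F[S,T]$ for the submatrix of $F$ with rows in $S$ and columns in $T$, and let $\rho(C)$ be the spectral radius of a square matrix $C$. A nonnegative square matrix $C$ is irreducible if the digraph with an edge $(i,j)$ whenever $c_{ij}>0$ is strongly connected (a single vertex without edges counts as strongly connected). A PF-eigenvector of $C$ is a nonzero $z\ge 0$ with $Cz=\rho(C)z$.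 Let $\mathcal{E}(A,B)$ be the set of all $w\in\Pi_n$ satisfying the following conditions. 1. $w$ has $\ell\le m$ nonzero coordinates. 2. The set $\mathcal{I}$ of zero rows of $B[[m],\operatorname{supp}w]$ has exactly $m-\ell$ elements. 3. $A[\mathcal{I},\operatorname{supp}w]=0$. 4. The matrix $C(w)=B[[m]\setminus\mathcal{I},\operatorname{supp}w]^{-1}A[[m]\setminus\mathcal{I},\operatorname{supp}w]$ is irreducible. 5. The restriction of $w$ to $\operatorname{supp}w$ is a PF-eigenvector of $C(w)$. Then: (a) $\mathcal{E}(A,B)$ is finite. (b) For each $w\in\mathcal{E}(A,B)$ the square matrix $B[[m]\setminus\mathcal{I},\operatorname{supp}w]$ is monomial (each row and each column has exactly one nonzero entry, and this entry is positive), $\rho(C(w))=r(A,B,w)$, and $Aw=\rho(C(w))Bw$. (c) $\hat\rho(A,B)=\min\{r(A,B,w):\ w\in\mathcal{E}(A,B)\}$; in particular the minimum is attained. (d) A vector $y\in\Pi_n$ is minimal weakly optimal if and only if $y\in\mathcal{E}(A,B)$ and $y$ attains the minimum in (c). (e) Every minimal weakly optimal vector (normalized or not) is a weak GPF-eigenvector.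 -/

import Mathlib

open scoped ENNReal NNReal Matrix

noncomputable section

namespace CollatzWielandt

/-- The quotient `r(A,B,x) = inf {t ≥ 0 : A x ≤ t B x}`, with values in `[0,∞]`
(the infimum of the empty set is `∞`). -/
def cwQuotient {m n : ℕ} (A B : Matrix (Fin m) (Fin n) ℝ) (x : Fin n → ℝ) : ℝ≥0∞ :=
  ⨅ (t : ℝ≥0) (_ : A *ᵥ x ≤ (t : ℝ) • (B *ᵥ x)), (t : ℝ≥0∞)

/-- The weak Collatz-Wielandt quotient: the infimum of `r(A,B,x)` over all nonzero
nonnegative vectors `x`. -/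
def weakCW {m n : ℕ} (A B : Matrix (Fin m) (Fin n) ℝ) : ℝ≥0∞ :=
  ⨅ (x : Fin n → ℝ) (_ : 0 ≤ x ∧ x ≠ 0), cwQuotient A B x

/-- A nonzero nonnegative vector that attains the weak Collatz-Wielandt quotient. -/
def IsWeaklyOptimal {m n : ℕ} (A B : Matrix (Fin m) (Fin n) ℝ) (y : Fin n → ℝ) : Prop :=
  (0 ≤ y ∧ y ≠ 0) ∧ cwQuotient A B y = weakCW A B

/-- A weakly optimal vector such that no weakly optimal vector has strictly smaller support. -/
def IsMinimalWeaklyOptimal {m n : ℕ} (A B : Matrix (Fin m) (Fin n) ℝ) (y : Fin n → ℝ) : Prop :=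
  IsWeaklyOptimal A B y ∧
    ¬ ∃ x : Fin n → ℝ, IsWeaklyOptimal A B x ∧ Function.support x ⊂ Function.support y

/-- A nonzero nonnegative `y` with `A y = ρ̂(A,B) B y`, where `ρ̂(A,B)` is finite. -/
def IsWeakGPFEigenvector {m n : ℕ} (A B : Matrix (Fin m) (Fin n) ℝ) (y : Fin n → ℝ) : Prop :=
  (0 ≤ y ∧ y ≠ 0) ∧ weakCW A B ≠ ∞ ∧ A *ᵥ y = (weakCW A B).toReal • (B *ᵥ y)

/-- A WN-pair (wireless network pair). -/
structure IsWNPair {m n : ℕ} (A B : Matrix (Fin m) (Fin n) ℝ) : Prop where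
  nonneg_left : ∀ i j, 0 ≤ A i j
  nonneg_right : ∀ i j, 0 ≤ B i j
  le : m ≤ n
  no_zero_row : ∀ i, ∃ j, B i j ≠ 0
  one_pos_per_column : ∀ j, ∃! i, 0 < B i j

/-- The support of a vector, as a finite set of indices. -/
def supp {n : ℕ} (w : Fin n → ℝ) : Finset (Fin n) := Finset.univ.filter fun j => w j ≠ 0

/-- The submatrix `F[S,T]` with rows in `S` and columns in `T`. -/
def block {m n : ℕ} (F : Matrix (Fin m) (Fin n) ℝ) (S : Finset (Fin m)) (T : Finset (Fin n)) :
    Matrix S T ℝ :=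
  F.submatrix (fun i => (i : Fin m)) (fun j => (j : Fin n))

open Classical in
/-- The indices of the zero rows of the submatrix `B[[m], T]`. -/
def zeroRows {m n : ℕ} (B : Matrix (Fin m) (Fin n) ℝ) (T : Finset (Fin n)) : Finset (Fin m) :=
  Finset.univ.filter fun i => ∀ j ∈ T, B i j = 0

/-- Each row and each column has exactly one nonzero entry, and the nonzero entries are positive.
(For index sets of the same size: a permutation matrix times a positive diagonal matrix.) -/
structure IsMonomial {R S : Type*} (M : Matrix R S ℝ) : Prop where
  nonneg : ∀ i j, 0 ≤ M i j
  row : ∀ i, ∃! j, M i j ≠ 0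
  col : ∀ j, ∃! i, M i j ≠ 0

open Classical in
/-- The two-sided inverse of a matrix whose rows and columns may be labelled by different sets
(`0` if there is none). Mathlib's inverse needs the two index types to coincide. -/
def blockInv {R S : Type*} [Fintype R] [Fintype S] [DecidableEq R] [DecidableEq S]
    (M : Matrix R S ℝ) : Matrix S R ℝ :=
  if h : ∃ X : Matrix S R ℝ, X * M = 1 ∧ M * X = 1 then h.choose else 0

theorem blockInv_eq {R S : Type*} [Fintype R] [Fintype S] [DecidableEq R] [DecidableEq S]
    {M : Matrix R S ℝ} {X : Matrix S R ℝ} (h₁ : X * M = 1) (h₂ : M * X = 1) :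
    blockInv M = X := by
  have h : ∃ X : Matrix S R ℝ, X * M = 1 ∧ M * X = 1 := ⟨X, h₁, h₂⟩
  have e : blockInv M = h.choose := dif_pos h
  calc blockInv M = blockInv M * (M * X) := by rw [h₂, Matrix.mul_one]
    _ = (blockInv M * M) * X := by rw [Matrix.mul_assoc]
    _ = X := by rw [e, h.choose_spec.1, Matrix.one_mul]

theorem blockInv_eq_inv {S : Type*} [Fintype S] [DecidableEq S] {M : Matrix S S ℝ}
    (h : IsUnit M.det) : blockInv M = M⁻¹ :=
  blockInv_eq (Matrix.nonsing_inv_mul M h) (Matrix.mul_nonsing_inv M h)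

/-- A nonnegative square matrix whose digraph (an edge from `i` to `j` when the entry `(i,j)` is
positive) is strongly connected. Here, unlike for `Matrix.IsIrreducible`, a digraph with one
vertex and no edge counts as strongly connected, so that the `1 × 1` zero matrix is
irreducible. -/
def IsIrred {S : Type*} (C : Matrix S S ℝ) : Prop :=
  (∀ i j, 0 ≤ C i j) ∧ @Quiver.IsStronglyConnected S C.toQuiver

/-- The spectral radius of a real square matrix: the largest modulus of a complex eigenvalue. -/
def specRad {S : Type*} [Fintype S] [DecidableEq S] (C : Matrix S S ℝ) : ℝ≥0∞ :=
  spectralRadius ℂ (C.map (fun x : ℝ => (x : ℂ)))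

theorem specRad_ne_top {S : Type*} [Fintype S] [DecidableEq S] (C : Matrix S S ℝ) :
    specRad C ≠ ∞ := by
  have hf : (spectrum ℂ (C.map (fun x : ℝ => (x : ℂ)))).Finite := Matrix.finite_spectrum _
  have : specRad C < ∞ := by
    unfold specRad spectralRadius
    rw [← hf.coe_toFinset]
    simp only [Finset.mem_coe]
    rw [← Finset.sup_eq_iSup, Finset.sup_lt_iff (by simp)]
    intro b _
    exact ENNReal.coe_lt_top
  exact this.ne

/-- A Perron-Frobenius eigenvector of `C`: `C z = ρ(C) z` with `z` nonnegative and nonzero. -/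
def IsPFEigenvector {S : Type*} [Fintype S] [DecidableEq S] (C : Matrix S S ℝ) (z : S → ℝ) :
    Prop :=
  (0 ≤ z ∧ z ≠ 0) ∧ C *ᵥ z = (specRad C).toReal • z

/-- The block of `F` with columns `supp w` and rows the nonzero rows of `B[[m], supp w]`. -/
def activeBlock {m n : ℕ} (B F : Matrix (Fin m) (Fin n) ℝ) (w : Fin n → ℝ) :
    Matrix ((zeroRows B (supp w))ᶜ : Finset (Fin m)) (supp w) ℝ :=
  block F (zeroRows B (supp w))ᶜ (supp w)

/-- The matrix `C(w) = B[[m] \ I, supp w]⁻¹ A[[m] \ I, supp w]`, where `I` is the set of zero rows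
of `B[[m], supp w]`. -/
def cMatrix {m n : ℕ} (A B : Matrix (Fin m) (Fin n) ℝ) (w : Fin n → ℝ) :
    Matrix (supp w) (supp w) ℝ :=
  blockInv (activeBlock B B w) * activeBlock B A w

/-- Membership of `w` in the set `E(A,B)`. -/
structure IsExtremal {m n : ℕ} (A B : Matrix (Fin m) (Fin n) ℝ) (w : Fin n → ℝ) : Prop where
  mem_simplex : w ∈ stdSimplex ℝ (Fin n)
  card_supp_le : (supp w).card ≤ m
  card_zeroRows : (zeroRows B (supp w)).card + (supp w).card = m
  block_eq_zero : block A (zeroRows B (supp w)) (supp w) = 0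
  irreducible : IsIrred (cMatrix A B w)
  pf : IsPFEigenvector (cMatrix A B w) (fun j => w j)

/-- The set `E(A,B)`. -/
def extremalSet {m n : ℕ} (A B : Matrix (Fin m) (Fin n) ℝ) : Set (Fin n → ℝ) :=
  {w | IsExtremal A B w}

end CollatzWielandt

end

open CollatzWielandt

/-! Write L for the weak quotient. It is finite, and by compactness of the simplex it is attained,
so the weakly optimal vectors are the nonzero x ≥ 0 with Ax ≤ L Bx. Let y be one of minimal support
T, and let S be the set of nonzero rows of B[[m],T]. Each column of B has one positive entry, so |S|
≤ |T|.

Consider the map g = (A - LB)[S,T]. It is not onto: a preimage of (-1,...,-1) would be a direction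
in which y can be pushed to beat L (`IsWeaklyOptimal.not_strict_direction`). Its kernel is at most
the line through y: moving y along any other kernel vector until a coordinate vanishes would give a
weakly optimal vector of smaller support (`IsMinimalWeaklyOptimal.eq_smul`). Rank-nullity then
forces |S| = |T| and a nonzero kernel, so Ay = L By (`IsMinimalWeaklyOptimal.mulVec_eq_and_card`).
Minimality also makes C(y) irreducible, since y could otherwise be set to zero on a set closed under
successors; hence a normalized y lies in E(A,B) (`IsMinimalWeaklyOptimal.isExtremal`).

Conversely, irreducibility of C(w) forbids subinvariant vectors with smaller nonempty support
(`IsExtremal.ne_zero_of_mulVec_le`). This makes weakly optimal members of E(A,B) minimal, and makes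
a member determined by its support, whence finiteness. -/

namespace CollatzWielandt

/-! ### Finiteness and attainment of the weak quotient -/

section Quotient

variable {m n : ℕ} {A B : Matrix (Fin m) (Fin n) ℝ} {x : Fin n → ℝ}

theorem mulVec_apply {R S : Type*} [Fintype S] (M : Matrix R S ℝ) (x : S → ℝ) (i : R) :
    (M *ᵥ x) i = ∑ j, M i j * x j := rfl

theorem mulVec_nonneg {M : Matrix (Fin m) (Fin n) ℝ} (hM : ∀ i j, 0 ≤ M i j) (hx : 0 ≤ x) :
    0 ≤ M *ᵥ x := fun i => by
  rw [mulVec_apply]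
  exact Finset.sum_nonneg fun j _ => mul_nonneg (hM i j) (hx j)

/-- The map σ sends a column to the row of its only nonzero entry; the structure of B enters the
block computations through it. -/
theorem IsWNPair.exists_row (h : IsWNPair A B) :
    ∃ σ : Fin n → Fin m, (∀ j, 0 < B (σ j) j) ∧ (∀ i j, B i j ≠ 0 → i = σ j) := by
  choose σ hσ using h.one_pos_per_column
  exact ⟨σ, fun j => (hσ j).1, fun i j hij =>
    (hσ j).2 i (lt_of_le_of_ne (h.nonneg_right i j) (Ne.symm hij))⟩

theorem IsWNPair.exists_mulVec_pos (h : IsWNPair A B) (hx : 0 ≤ x) {j : Fin n} (hj : x j ≠ 0) :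
    ∃ i, 0 < B i j ∧ 0 < (B *ᵥ x) i := by
  obtain ⟨i, hi, -⟩ := h.one_pos_per_column j
  refine ⟨i, hi, lt_of_lt_of_le (mul_pos hi (lt_of_le_of_ne (hx j) (Ne.symm hj))) ?_⟩
  exact Finset.single_le_sum (f := fun j => B i j * x j)
    (fun k _ => mul_nonneg (h.nonneg_right i k) (hx k)) (Finset.mem_univ j)

theorem cwQuotient_le_of_le {t : ℝ≥0} (h : A *ᵥ x ≤ (t : ℝ) • (B *ᵥ x)) :
    cwQuotient A B x ≤ t := iInf₂_le t h

/-- The infimum in the definition of `r(A,B,x)` is attained when it is finite. -/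
theorem cwQuotient_le_iff (hB : ∀ i j, 0 ≤ B i j) (hx : 0 ≤ x) {t : ℝ≥0} :
    cwQuotient A B x ≤ t ↔ A *ᵥ x ≤ (t : ℝ) • (B *ᵥ x) := by
  refine ⟨fun h i => ?_, cwQuotient_le_of_le⟩
  have hBx : 0 ≤ (B *ᵥ x) i := mulVec_nonneg hB hx i
  have key : ∀ s : ℝ≥0, t < s → (A *ᵥ x) i ≤ (s : ℝ) * (B *ᵥ x) i := by
    intro s hs
    have h1 : cwQuotient A B x < s := lt_of_le_of_lt h (by exact_mod_cast hs)
    simp only [cwQuotient, iInf_lt_iff] at h1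
    obtain ⟨u, hu, hus⟩ := h1
    have hus' : (u : ℝ) ≤ s := by exact_mod_cast hus.le
    exact (hu i).trans (mul_le_mul_of_nonneg_right hus' hBx)
  have hlim : Filter.Tendsto (fun s : ℝ => s * (B *ᵥ x) i) (nhdsWithin (t : ℝ) (Set.Ioi t))
      (nhds ((t : ℝ) * (B *ᵥ x) i)) :=
    ((continuous_id.mul continuous_const).tendsto (t : ℝ)).mono_left nhdsWithin_le_nhds
  refine ge_of_tendsto hlim ?_
  filter_upwards [self_mem_nhdsWithin] with s hs
  have hs' : (t : ℝ) < s := hs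
  exact key ⟨s, t.coe_nonneg.trans hs'.le⟩ hs'

theorem weakCW_le (hx : 0 ≤ x) (hx0 : x ≠ 0) : weakCW A B ≤ cwQuotient A B x :=
  iInf₂_le x ⟨hx, hx0⟩

theorem IsWNPair.weakCW_ne_top (h : IsWNPair A B) (hm : 0 < m) : weakCW A B ≠ ∞ := by
  have hn : 0 < n := hm.trans_le h.le
  set x : Fin n → ℝ := fun _ => 1
  have hx : 0 ≤ x := fun _ => zero_le_one
  have hx0 : x ≠ 0 := fun e => one_ne_zero (congrFun e ⟨0, hn⟩)
  have hpos : ∀ i, 0 < (B *ᵥ x) i := by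
    intro i
    obtain ⟨j, hj⟩ := h.no_zero_row i
    have := lt_of_le_of_ne (h.nonneg_right i j) (Ne.symm hj)
    refine lt_of_lt_of_le (this.trans_eq (mul_one _).symm) ?_
    exact Finset.single_le_sum (f := fun j => B i j * x j)
      (fun k _ => mul_nonneg (h.nonneg_right i k) (hx k)) (Finset.mem_univ j)
  have hA : ∀ i, 0 ≤ (A *ᵥ x) i / (B *ᵥ x) i := fun i =>
    div_nonneg (mulVec_nonneg h.nonneg_left hx i) (hpos i).le
  have ht0 : 0 ≤ ∑ i, (A *ᵥ x) i / (B *ᵥ x) i := Finset.sum_nonneg fun i _ => hA i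
  refine ne_top_of_le_ne_top ENNReal.coe_ne_top
    ((weakCW_le hx hx0).trans (cwQuotient_le_of_le (t := ⟨_, ht0⟩) fun i => ?_))
  have := Finset.single_le_sum (f := fun i => (A *ᵥ x) i / (B *ᵥ x) i) (fun k _ => hA k)
    (Finset.mem_univ i)
  exact (div_le_iff₀ (hpos i)).1 this

/-- Weak optimality as a linear inequality. -/
theorem IsWNPair.isWeaklyOptimal_iff (h : IsWNPair A B) (hm : 0 < m) :
    IsWeaklyOptimal A B x ↔
      (0 ≤ x ∧ x ≠ 0) ∧ A *ᵥ x ≤ (weakCW A B).toReal • (B *ᵥ x) := by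
  refine and_congr_right fun hx => ?_
  rw [← ENNReal.coe_toNNReal_eq_toReal, ← cwQuotient_le_iff h.nonneg_right hx.1,
    ENNReal.coe_toNNReal (h.weakCW_ne_top hm)]
  exact ⟨fun e => e.le, fun e => e.antisymm (weakCW_le hx.1 hx.2)⟩

/-- The weak Collatz-Wielandt quotient is attained. -/
theorem IsWNPair.exists_isWeaklyOptimal (h : IsWNPair A B) (hm : 0 < m) :
    ∃ x, IsWeaklyOptimal A B x := by
  set L := weakCW A B with hL
  have hLtop : L ≠ ∞ := h.weakCW_ne_top hm
  -- The sets K k are nonempty, compact and decreasing; a point common to all of them attains L.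
  let t : ℕ → ℝ≥0 := fun k => L.toNNReal + 1 / (k + 1)
  let K : ℕ → Set (Fin n → ℝ) := fun k =>
    {x | x ∈ stdSimplex ℝ (Fin n) ∧ A *ᵥ x ≤ (t k : ℝ) • (B *ᵥ x)}
  have hclosed : ∀ k, IsClosed (K k) := by
    intro k
    have hA : Continuous fun x : Fin n → ℝ => A *ᵥ x := by fun_prop
    have hB : Continuous fun x : Fin n → ℝ => (t k : ℝ) • (B *ᵥ x) := by fun_prop
    exact (isClosed_stdSimplex ℝ (Fin n)).inter (isClosed_le hA hB)
  have hne : ∀ k, (K k).Nonempty := by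
    intro k
    have hlt : L < t k := by
      rw [← ENNReal.coe_toNNReal hLtop]
      exact_mod_cast lt_add_of_pos_right _ (by positivity)
    rw [hL] at hlt
    simp only [weakCW, iInf_lt_iff] at hlt
    obtain ⟨x, ⟨hx, hx0⟩, hxt⟩ := hlt
    have hxt' := (cwQuotient_le_iff h.nonneg_right hx).1 hxt.le
    have hs : 0 < ∑ j, x j := by
      obtain ⟨j, hj⟩ := Function.ne_iff.1 hx0
      exact Finset.sum_pos' (fun j _ => hx j)
        ⟨j, Finset.mem_univ j, lt_of_le_of_ne (hx j) (Ne.symm hj)⟩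
    refine ⟨(∑ j, x j)⁻¹ • x, ⟨fun j => mul_nonneg (inv_nonneg.2 hs.le) (hx j), ?_⟩, ?_⟩
    · simp [← Finset.mul_sum, inv_mul_cancel₀ hs.ne']
    · rw [Matrix.mulVec_smul, Matrix.mulVec_smul, smul_comm]
      exact smul_le_smul_of_nonneg_left hxt' (inv_nonneg.2 hs.le)
  have hmono : ∀ k, K (k + 1) ⊆ K k := by
    rintro k x ⟨hx, hxt⟩
    refine ⟨hx, hxt.trans fun i => mul_le_mul_of_nonneg_right ?_
      (mulVec_nonneg h.nonneg_right hx.1 i)⟩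
    have : (1 : ℝ) / ((k + 1 : ℕ) + 1) ≤ 1 / (k + 1) := by
      push_cast
      exact one_div_le_one_div_of_le (by positivity) (by linarith)
    simpa [t] using this
  obtain ⟨x, hx⟩ := IsCompact.nonempty_iInter_of_sequence_nonempty_isCompact_isClosed K hmono hne
    ((isCompact_stdSimplex ℝ (Fin n)).of_isClosed_subset (hclosed 0) fun x hx => hx.1) hclosed
  rw [Set.mem_iInter] at hx
  have hxs := (hx 0).1
  refine ⟨x, (h.isWeaklyOptimal_iff hm).2 ⟨⟨hxs.1, ?_⟩, fun i => ?_⟩⟩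
  · rintro rfl
    simpa using hxs.2
  · have hlim : Filter.Tendsto (fun k : ℕ => (L.toReal + 1 / ((k : ℝ) + 1)) * (B *ᵥ x) i)
        Filter.atTop (nhds ((L.toReal + 0) * (B *ᵥ x) i)) :=
      (tendsto_const_nhds.add tendsto_one_div_add_atTop_nhds_zero_nat).mul_const _
    rw [add_zero] at hlim
    refine ge_of_tendsto' hlim fun k => ?_
    simpa [t, ENNReal.coe_toNNReal_eq_toReal] using (hx k).2 i

/-- No nonzero nonnegative vector improves strictly on the weak Collatz-Wielandt quotient in
all the rows that matter. -/
theorem IsWNPair.not_strict (h : IsWNPair A B) (hm : 0 < m) (hx : 0 ≤ x)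
    (h1 : ∀ i, (A *ᵥ x) i < (weakCW A B).toReal * (B *ᵥ x) i ∨ (A *ᵥ x) i = 0)
    (h2 : ∃ i, (A *ᵥ x) i < (weakCW A B).toReal * (B *ᵥ x) i) : False := by
  have hAx := mulVec_nonneg h.nonneg_left hx
  have hBx := mulVec_nonneg h.nonneg_right hx
  have hpos : ∀ i, (A *ᵥ x) i < (weakCW A B).toReal * (B *ᵥ x) i → 0 < (B *ᵥ x) i := by
    intro i hi
    refine lt_of_le_of_ne (hBx i) fun e => ?_
    rw [← e] at hi
    have : 0 ≤ (A *ᵥ x) i := hAx i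
    simp only [mul_zero] at hi
    linarith
  have hx0 : x ≠ 0 := by
    rintro rfl
    obtain ⟨i, hi⟩ := h2
    simp at hi
  have : Nonempty (Fin m) := ⟨⟨0, hm⟩⟩
  -- Where Bx vanishes, so does Ax, and the ratio is 0/0 = 0; such rows do not disturb the maximum.
  obtain ⟨i₀, hi₀⟩ := Finite.exists_max fun i => (A *ᵥ x) i / (B *ᵥ x) i
  have ht0 : 0 ≤ (A *ᵥ x) i₀ / (B *ᵥ x) i₀ := div_nonneg (hAx i₀) (hBx i₀)
  have hle : weakCW A B ≤ ENNReal.ofReal ((A *ᵥ x) i₀ / (B *ᵥ x) i₀) := by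
    refine (weakCW_le hx hx0).trans (cwQuotient_le_of_le fun i => ?_)
    rw [Real.coe_toNNReal _ ht0]
    rcases h1 i with hi | hi
    · exact (div_le_iff₀ (hpos i hi)).1 (hi₀ i)
    · rw [hi]
      exact mul_nonneg ht0 (hBx i)
  have hle' : (weakCW A B).toReal ≤ (A *ᵥ x) i₀ / (B *ᵥ x) i₀ :=
    ENNReal.toReal_le_of_le_ofReal ht0 hle
  rcases h1 i₀ with hi | hi
  · rw [le_div_iff₀ (hpos i₀ hi)] at hle'
    exact absurd hi (not_lt.2 hle')
  -- The largest ratio is 0 here, so L ≤ 0, which the strict row excludes.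
  · rw [hi, zero_div] at hle'
    obtain ⟨i, hi⟩ := h2
    have h3 := mul_nonneg (sub_nonneg.2 hle') (hBx i)
    have h4 : 0 ≤ (A *ᵥ x) i := hAx i
    simp only [zero_sub, neg_mul] at h3
    linarith

end Quotient

/-! ### Moving to the boundary of the orthant -/

section Ray

/-- Moving from a nonnegative vector against a direction with a positive coordinate until a
coordinate vanishes. -/
theorem exists_sub_smul_nonneg {n : ℕ} {y v : Fin n → ℝ} (hy : 0 ≤ y)
    (hv : ∀ j, y j = 0 → v j = 0) (hpos : ∃ j, 0 < v j) :
    ∃ s : ℝ, 0 < s ∧ 0 ≤ y - s • v ∧ ∃ j, y j ≠ 0 ∧ (y - s • v) j = 0 := by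
  classical
  obtain ⟨j₀, hj₀⟩ := hpos
  -- Ratio test: the step length is the smallest y j / v j with v j > 0.
  obtain ⟨k, hk, hmin⟩ := (Finset.univ.filter fun j => 0 < v j).exists_min_image
    (fun j => y j / v j) ⟨j₀, by simpa using hj₀⟩
  have hk' : 0 < v k := by simpa using hk
  have hyk : y k ≠ 0 := fun e => hk'.ne' (hv k e)
  have hyk' : 0 < y k := lt_of_le_of_ne (hy k) (Ne.symm hyk)
  refine ⟨y k / v k, div_pos hyk' hk', fun j => ?_, k, hyk, ?_⟩
  · simp only [Pi.zero_apply, Pi.sub_apply, Pi.smul_apply, smul_eq_mul, sub_nonneg]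
    rcases lt_or_ge 0 (v j) with hj | hj
    · exact (le_div_iff₀ hj).1 (hmin j (by simpa using hj))
    · exact (mul_nonpos_of_nonneg_of_nonpos (div_pos hyk' hk').le hj).trans (hy j)
  · simp [div_mul_cancel₀ _ hk'.ne']

end Ray

/-! ### Spectral radius and irreducibility -/

section Spectrum

/-- A nonnegative matrix with a positive eigenvector has the eigenvalue as spectral radius. -/
theorem specRad_eq_of_pos_eigenvector {S : Type*} [Fintype S] [DecidableEq S] [Nonempty S]
    {C : Matrix S S ℝ} (hC : ∀ i j, 0 ≤ C i j) {y : S → ℝ} (hy : ∀ i, 0 < y i) {c : ℝ}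
    (hc : 0 ≤ c) (h : C *ᵥ y = c • y) : specRad C = ENNReal.ofReal c := by
  have hy' : ∀ i, ∑ j, C i j * y j = c * y i := fun i => congrFun h i
  set D : Matrix S S ℂ := C.map fun x : ℝ => (x : ℂ) with hD
  have hspec : ∀ μ : ℂ, μ ∈ spectrum ℂ D ↔ Module.End.HasEigenvalue (Matrix.toLin' D) μ := by
    intro μ
    rw [Module.End.hasEigenvalue_iff_mem_spectrum, Matrix.spectrum_toLin']
  refine le_antisymm (iSup₂_le fun μ hμ => ?_) ?_
  · obtain ⟨z, hz⟩ := ((hspec μ).1 hμ).exists_hasEigenvector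
    have hz' : ∀ i, ∑ j, (C i j : ℂ) * z j = μ * z i := fun i => congrFun hz.apply_eq_smul i
    -- Row k, where |z| is largest relative to y, bounds |μ|: replacing each |z j| by its bound (|z
    -- k| / y k) y j reduces the row sum to Cy = cy.
    obtain ⟨k, hk⟩ := Finite.exists_max fun i => ‖z i‖ / y i
    have hzk : 0 < ‖z k‖ := by
      obtain ⟨i, hi⟩ := Function.ne_iff.1 hz.2
      have h1 : 0 < ‖z i‖ / y i := div_pos (norm_pos_iff.2 hi) (hy i)
      have h2 := (div_pos_iff_of_pos_right (hy k)).1 (h1.trans_le (hk i))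
      exact h2
    have hle : ‖μ‖ * ‖z k‖ ≤ c * ‖z k‖ := by
      calc ‖μ‖ * ‖z k‖ = ‖∑ j, (C k j : ℂ) * z j‖ := by rw [hz', norm_mul]
        _ ≤ ∑ j, ‖(C k j : ℂ) * z j‖ := norm_sum_le _ _
        _ = ∑ j, C k j * ‖z j‖ := by
          refine Finset.sum_congr rfl fun j _ => ?_
          rw [norm_mul, Complex.norm_real, Real.norm_of_nonneg (hC k j)]
        _ ≤ ∑ j, C k j * (‖z k‖ / y k * y j) := Finset.sum_le_sum fun j _ =>
          mul_le_mul_of_nonneg_left ((div_le_iff₀ (hy j)).1 (hk j)) (hC k j)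
        _ = ‖z k‖ / y k * ∑ j, C k j * y j := by
          rw [Finset.mul_sum]
          exact Finset.sum_congr rfl fun j _ => by ring
        _ = c * ‖z k‖ := by
          rw [hy']
          field_simp [(hy k).ne']
    have : ‖μ‖ ≤ c := le_of_mul_le_mul_right hle hzk
    rw [← enorm_eq_nnnorm, ← ofReal_norm]
    exact ENNReal.ofReal_le_ofReal this
  · have hmem : (c : ℂ) ∈ spectrum ℂ D := by
      rw [hspec]
      refine Module.End.hasEigenvalue_of_hasEigenvector (x := fun i => (y i : ℂ))
        (Module.End.hasEigenvector_iff.2 ⟨Module.End.mem_eigenspace_iff.2 ?_, ?_⟩)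
      · funext i
        rw [Matrix.toLin'_apply]
        have := congrArg (fun r : ℝ => (r : ℂ)) (hy' i)
        push_cast at this
        exact this
      · intro e
        obtain ⟨i⟩ := ‹Nonempty S›
        have := congrFun e i
        simp only [Pi.zero_apply, Complex.ofReal_eq_zero] at this
        exact (hy i).ne' this
    refine le_trans ?_ (le_iSup₂ (f := fun k (_ : k ∈ spectrum ℂ D) => (‖k‖₊ : ℝ≥0∞)) _ hmem)
    rw [← enorm_eq_nnnorm, ← ofReal_norm, Complex.norm_real, Real.norm_of_nonneg hc]

/-- Irreducibility in terms of sets of indices that are closed under taking successors. -/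
theorem isIrred_iff {S : Type*} {C : Matrix S S ℝ} :
    IsIrred C ↔ (∀ i j, 0 ≤ C i j) ∧
      ∀ Z : Set S, Z.Nonempty → (∀ a ∈ Z, ∀ b, 0 < C a b → b ∈ Z) → Z = Set.univ := by
  let _ : Quiver S := C.toQuiver
  refine and_congr_right fun _ => ⟨fun h Z ⟨a, ha⟩ hZ => ?_, fun h i j => ?_⟩
  · refine Set.eq_univ_of_forall fun b => ?_
    obtain ⟨p⟩ := h a b
    induction p with
    | nil => exact ha
    | cons _ e ih => exact hZ _ ih _ e.down
  · have := h {b | Nonempty (Quiver.Path i b)} ⟨i, ⟨.nil⟩⟩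
      (fun a ⟨p⟩ b hab => ⟨p.cons (PLift.up hab)⟩)
    exact (Set.ext_iff.1 this j).2 trivial

end Spectrum

/-! ### The active block of B and the matrix C(w) -/

section Blocks

variable {m n : ℕ} {A B : Matrix (Fin m) (Fin n) ℝ} {σ : Fin n → Fin m} {w x : Fin n → ℝ}

theorem mem_supp {j : Fin n} : j ∈ supp w ↔ w j ≠ 0 := by simp [supp]

theorem mem_zeroRows {T : Finset (Fin n)} {i : Fin m} :
    i ∈ zeroRows B T ↔ ∀ j ∈ T, B i j = 0 := by simp [zeroRows]

theorem mulVec_eq_zero_of_row {M : Matrix (Fin m) (Fin n) ℝ} {i : Fin m}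
    (hM : ∀ j ∈ supp w, M i j = 0) (hx : ∀ j, w j = 0 → x j = 0) : (M *ᵥ x) i = 0 := by
  rw [mulVec_apply]
  refine Finset.sum_eq_zero fun j _ => ?_
  by_cases hj : w j = 0
  · rw [hx j hj, mul_zero]
  · rw [hM j (mem_supp.2 hj), zero_mul]

theorem compl_zeroRows (hσ : ∀ j, 0 < B (σ j) j) (hσ' : ∀ i j, B i j ≠ 0 → i = σ j)
    (T : Finset (Fin n)) : (zeroRows B T)ᶜ = T.image σ := by
  ext i
  simp only [Finset.mem_compl, mem_zeroRows, Finset.mem_image, not_forall]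
  constructor
  · rintro ⟨j, hj, hij⟩
    exact ⟨j, hj, (hσ' i j hij).symm⟩
  · rintro ⟨j, hj, rfl⟩
    exact ⟨j, hj, (hσ j).ne'⟩

/-- The nonzero rows of B[[m],T] form the image σ(T), so the cardinality condition says that σ loses
no element of T. -/
theorem injOn_of_card_eq (hσ : ∀ j, 0 < B (σ j) j) (hσ' : ∀ i j, B i j ≠ 0 → i = σ j)
    {T : Finset (Fin n)} (hT : (zeroRows B T).card + T.card = m) : Set.InjOn σ T := by
  rw [← Finset.card_image_iff, ← compl_zeroRows hσ hσ', Finset.card_compl, Fintype.card_fin]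
  omega

theorem mulVec_apply_of_injOn (hσ' : ∀ i j, B i j ≠ 0 → i = σ j) (hinj : Set.InjOn σ (supp w))
    (hx : ∀ j, w j = 0 → x j = 0) {j : Fin n} (hj : j ∈ supp w) :
    (B *ᵥ x) (σ j) = B (σ j) j * x j := by
  rw [mulVec_apply]
  refine Finset.sum_eq_single j (fun k _ hkj => ?_) (fun h => absurd (Finset.mem_univ j) h)
  by_cases hk : w k = 0
  · rw [hx k hk, mul_zero]
  · by_cases hB : B (σ j) k = 0
    · rw [hB, zero_mul]
    · exact absurd (hinj (mem_supp.2 hk) hj (hσ' _ _ hB).symm) hkj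

theorem isMonomial_activeBlock (hσ : ∀ j, 0 < B (σ j) j) (hσ' : ∀ i j, B i j ≠ 0 → i = σ j)
    (hB : ∀ i j, 0 ≤ B i j) (hinj : Set.InjOn σ (supp w)) : IsMonomial (activeBlock B B w) where
  nonneg i j := hB i j
  row := by
    rintro ⟨i, hi⟩
    obtain ⟨j, hj, rfl⟩ := Finset.mem_image.1 (compl_zeroRows hσ hσ' (supp w) ▸ hi)
    exact ⟨⟨j, hj⟩, (hσ j).ne', fun k hk => Subtype.ext (hinj k.2 hj (hσ' _ _ hk).symm)⟩
  col := by
    rintro ⟨j, hj⟩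
    have hi : σ j ∈ (zeroRows B (supp w))ᶜ := by
      rw [compl_zeroRows hσ hσ']
      exact Finset.mem_image_of_mem σ hj
    exact ⟨⟨σ j, hi⟩, (hσ j).ne', fun k hk => Subtype.ext (hσ' _ _ hk)⟩

theorem blockInv_activeBlock (hσ : ∀ j, 0 < B (σ j) j) (hσ' : ∀ i j, B i j ≠ 0 → i = σ j)
    (hinj : Set.InjOn σ (supp w)) :
    blockInv (activeBlock B B w) =
      Matrix.of fun (j : supp w) (i : ((zeroRows B (supp w))ᶜ :)) => (B i j)⁻¹ := by
  have hmem : ∀ j ∈ supp w, σ j ∈ (zeroRows B (supp w))ᶜ := fun j hj => by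
    rw [compl_zeroRows hσ hσ']
    exact Finset.mem_image_of_mem σ hj
  apply blockInv_eq
  · ext ⟨j, hj⟩ ⟨k, hk⟩
    rw [Matrix.mul_apply, Finset.sum_eq_single (⟨σ j, hmem j hj⟩ : ((zeroRows B (supp w))ᶜ :))]
    · by_cases hjk : j = k
      · subst hjk
        simp [activeBlock, block, inv_mul_cancel₀ (hσ j).ne']
      · have h0 : B (σ j) k = 0 := by
          by_contra hB
          exact hjk (hinj hj hk (hσ' _ _ hB))
        simp [activeBlock, block, h0, hjk]
    · rintro ⟨i, hi⟩ - hij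
      have h0 : B i j = 0 := by
        by_contra hB
        exact hij (Subtype.ext (hσ' _ _ hB))
      simp [h0]
    · simp
  · ext ⟨i, hi⟩ ⟨i', hi'⟩
    obtain ⟨j, hj, rfl⟩ := Finset.mem_image.1 (compl_zeroRows hσ hσ' (supp w) ▸ hi)
    rw [Matrix.mul_apply, Finset.sum_eq_single (⟨j, hj⟩ : supp w)]
    · by_cases hjk : σ j = i'
      · subst hjk
        simp [activeBlock, block, mul_inv_cancel₀ (hσ j).ne']
      · have h0 : B i' j = 0 := by
          by_contra hB
          exact hjk (hσ' _ _ hB).symm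
        simp [activeBlock, block, h0, hjk]
    · rintro ⟨k, hk⟩ - hkj
      have h0 : B (σ j) k = 0 := by
        by_contra hB
        exact hkj (Subtype.ext (hinj hk hj (hσ' _ _ hB).symm))
      simp [activeBlock, block, h0]
    · simp

theorem cMatrix_apply (hσ : ∀ j, 0 < B (σ j) j) (hσ' : ∀ i j, B i j ≠ 0 → i = σ j)
    (hinj : Set.InjOn σ (supp w)) (j k : supp w) :
    cMatrix A B w j k = (B (σ j) j)⁻¹ * A (σ j) k := by
  have hmem : σ j ∈ (zeroRows B (supp w))ᶜ := by
    rw [compl_zeroRows hσ hσ']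
    exact Finset.mem_image_of_mem σ j.2
  rw [cMatrix, blockInv_activeBlock hσ hσ' hinj, Matrix.mul_apply,
    Finset.sum_eq_single (⟨σ j, hmem⟩ : ((zeroRows B (supp w))ᶜ :))]
  · rfl
  · rintro ⟨i, hi⟩ - hij
    have h0 : B i j = 0 := by
      by_contra hB
      exact hij (Subtype.ext (hσ' _ _ hB))
    simp [h0]
  · simp

/-- Lets statements about C(w) be read off in row σ j of A, without inverse matrices. -/
theorem cMatrix_mulVec_apply (hσ : ∀ j, 0 < B (σ j) j) (hσ' : ∀ i j, B i j ≠ 0 → i = σ j)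
    (hinj : Set.InjOn σ (supp w)) (hx : ∀ j, w j = 0 → x j = 0) (j : supp w) :
    (cMatrix A B w *ᵥ fun k => x k) j = (B (σ j) j)⁻¹ * (A *ᵥ x) (σ j) := by
  have h1 : (A *ᵥ x) (σ j) = ∑ k ∈ supp w, A (σ j) k * x k := by
    rw [mulVec_apply]
    refine (Finset.sum_subset (Finset.subset_univ _) fun k _ hk => ?_).symm
    rw [hx k (by simpa [mem_supp] using hk), mul_zero]
  rw [h1, mulVec_apply, ← Finset.sum_coe_sort (supp w), Finset.mul_sum]
  refine Finset.sum_congr rfl fun k _ => ?_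
  rw [cMatrix_apply hσ hσ' hinj, mul_assoc]

end Blocks

/-! ### Rigidity and finiteness of E(A,B) -/

section Extremal

variable {m n : ℕ} {A B : Matrix (Fin m) (Fin n) ℝ} {σ : Fin n → Fin m} {w x : Fin n → ℝ}

theorem IsExtremal.injOn (hσ : ∀ j, 0 < B (σ j) j) (hσ' : ∀ i j, B i j ≠ 0 → i = σ j)
    (hw : IsExtremal A B w) : Set.InjOn σ (supp w) :=
  injOn_of_card_eq hσ hσ' hw.card_zeroRows

theorem IsExtremal.ne_zero (hw : IsExtremal A B w) : w ≠ 0 := by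
  rintro rfl
  simpa using hw.mem_simplex.2

theorem IsExtremal.mulVec_eq (h : IsWNPair A B) (hw : IsExtremal A B w) :
    A *ᵥ w = (specRad (cMatrix A B w)).toReal • (B *ᵥ w) := by
  obtain ⟨σ, hσ, hσ'⟩ := h.exists_row
  have hinj := hw.injOn hσ hσ'
  funext i
  by_cases hi : i ∈ zeroRows B (supp w)
  · have hA : ∀ j ∈ supp w, A i j = 0 := fun j hj =>
      congrFun (congrFun hw.block_eq_zero ⟨i, hi⟩) ⟨j, hj⟩
    rw [Pi.smul_apply, mulVec_eq_zero_of_row hA fun _ h => h,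
      mulVec_eq_zero_of_row (mem_zeroRows.1 hi) fun _ h => h, smul_zero]
  · obtain ⟨j, hj, rfl⟩ :=
      Finset.mem_image.1 (compl_zeroRows hσ hσ' (supp w) ▸ Finset.mem_compl.2 hi)
    have h1 := congrFun hw.pf.2 ⟨j, hj⟩
    rw [cMatrix_mulVec_apply hσ hσ' hinj fun _ h => h] at h1
    simp only [Pi.smul_apply, smul_eq_mul] at h1 ⊢
    rw [mulVec_apply_of_injOn hσ' hinj (fun _ h => h) hj, mul_left_comm, ← h1, ← mul_assoc,
      mul_inv_cancel₀ (hσ j).ne', one_mul]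

theorem IsExtremal.specRad_eq (h : IsWNPair A B) (hw : IsExtremal A B w) :
    specRad (cMatrix A B w) = cwQuotient A B w := by
  have hρ := specRad_ne_top (cMatrix A B w)
  refine le_antisymm (le_iInf₂ fun t ht => ?_) ?_
  · obtain ⟨j, hj⟩ := Function.ne_iff.1 hw.ne_zero
    obtain ⟨i, -, hi⟩ := h.exists_mulVec_pos hw.mem_simplex.1 hj
    have h1 := ht i
    rw [hw.mulVec_eq h] at h1
    have h2 : (specRad (cMatrix A B w)).toReal ≤ t := le_of_mul_le_mul_right h1 hi
    rw [← ENNReal.ofReal_toReal hρ]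
    exact ENNReal.ofReal_le_of_le_toReal h2
  · rw [← ENNReal.coe_toNNReal hρ]
    refine cwQuotient_le_of_le ?_
    rw [ENNReal.coe_toNNReal_eq_toReal]
    exact (hw.mulVec_eq h).le

/-- A subinvariant vector supported in the support of a vector of `E(A,B)` has full support
there. -/
theorem IsExtremal.ne_zero_of_mulVec_le (h : IsWNPair A B) (hw : IsExtremal A B w) {t : ℝ}
    (hx : 0 ≤ x) (hx0 : x ≠ 0) (hsub : ∀ j, w j = 0 → x j = 0) (hle : A *ᵥ x ≤ t • (B *ᵥ x))
    {j : Fin n} (hj : w j ≠ 0) : x j ≠ 0 := by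
  obtain ⟨σ, hσ, hσ'⟩ := h.exists_row
  have hinj := hw.injOn hσ hσ'
  intro hxj
  -- The zero set of x is closed under successors: if x a = 0, then row σ a of the inequality forces
  -- Ax to vanish there, hence x b = 0 whenever C(w) has an edge from a to b.
  have hZ := (isIrred_iff.1 hw.irreducible).2 {a | x a = 0} ⟨⟨j, mem_supp.2 hj⟩, hxj⟩ (by
    intro a ha b hab
    have ha' : x a = 0 := ha
    have hAa : (A *ᵥ x) (σ a) ≤ 0 := by
      refine (hle (σ a)).trans_eq ?_
      rw [Pi.smul_apply, mulVec_apply_of_injOn hσ' hinj hsub a.2, ha', mul_zero, smul_zero]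
    have hnn : ∀ k ∈ Finset.univ, 0 ≤ A (σ a) k * x k := fun k _ =>
      mul_nonneg (h.nonneg_left _ k) (hx k)
    have hz := (Finset.sum_eq_zero_iff_of_nonneg hnn).1
      (le_antisymm hAa (Finset.sum_nonneg hnn)) b (Finset.mem_univ _)
    rw [cMatrix_apply hσ hσ' hinj] at hab
    exact (mul_eq_zero.1 hz).resolve_left (right_ne_zero_of_mul hab.ne'))
  refine hx0 (funext fun k => ?_)
  by_cases hk : w k = 0
  · exact hsub k hk
  · exact (Set.ext_iff.1 hZ ⟨k, mem_supp.2 hk⟩).2 trivial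

/-- The index type of C(w) depends on w only through its support, so the equality is proved for
arbitrary finsets, where it can be substituted. -/
theorem specRad_cMatrix_congr {w' : Fin n → ℝ} (hs : supp w = supp w') :
    specRad (cMatrix A B w) = specRad (cMatrix A B w') := by
  have key : ∀ T T' : Finset (Fin n), T = T' →
      specRad (blockInv (block B (zeroRows B T)ᶜ T) * block A (zeroRows B T)ᶜ T) =
      specRad (blockInv (block B (zeroRows B T')ᶜ T') * block A (zeroRows B T')ᶜ T') := by
    rintro T _ rfl
    rfl
  exact key _ _ hs

/-- Subtract from w the multiple of w' that first kills a coordinate. The difference satisfies the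
same eigenvector equation, so irreducibility makes it zero; normalization fixes the multiple. -/
theorem IsExtremal.eq_of_supp_eq (h : IsWNPair A B) {w' : Fin n → ℝ} (hw : IsExtremal A B w)
    (hw' : IsExtremal A B w') (hs : supp w = supp w') : w = w' := by
  have hz : ∀ j, w j = 0 ↔ w' j = 0 := fun j => by
    rw [← not_iff_not, ← ne_eq, ← ne_eq, ← mem_supp, ← mem_supp, hs]
  obtain ⟨j, hj⟩ := Function.ne_iff.1 hw'.ne_zero
  obtain ⟨s, -, hnn, k, hk, hk0⟩ := exists_sub_smul_nonneg hw.mem_simplex.1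
    (fun j hj => (hz j).1 hj) ⟨j, lt_of_le_of_ne (hw'.mem_simplex.1 j) (Ne.symm hj)⟩
  have heq : w - s • w' = 0 := by
    by_contra hne
    refine hw.ne_zero_of_mulVec_le h (t := (specRad (cMatrix A B w)).toReal) hnn hne
      (fun j hj => by simp [hj, (hz j).1 hj]) (le_of_eq ?_) hk hk0
    rw [Matrix.mulVec_sub, Matrix.mulVec_sub, Matrix.mulVec_smul, Matrix.mulVec_smul,
      hw.mulVec_eq h, hw'.mulVec_eq h, ← specRad_cMatrix_congr hs, smul_sub, smul_comm s]
  rw [sub_eq_zero] at heq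
  have hsum : s = 1 := by
    have h1 := hw.mem_simplex.2
    rw [heq] at h1
    simpa [← Finset.mul_sum, hw'.mem_simplex.2] using h1
  rw [heq, hsum, one_smul]

theorem finite_extremalSet (h : IsWNPair A B) : (extremalSet A B).Finite :=
  Set.Finite.of_finite_image (Set.toFinite (supp '' extremalSet A B))
    fun _ hw _ hw' hs => IsExtremal.eq_of_supp_eq h hw hw' hs

end Extremal

/-! ### Minimal weakly optimal vectors -/

section Minimal

variable {m n : ℕ} {A B : Matrix (Fin m) (Fin n) ℝ} {x y : Fin n → ℝ}

theorem IsWNPair.isMinimalWeaklyOptimal_iff (h : IsWNPair A B) (hm : 0 < m) :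
    IsMinimalWeaklyOptimal A B y ↔ IsWeaklyOptimal A B y ∧
      ∀ x : Fin n → ℝ, 0 ≤ x → x ≠ 0 → A *ᵥ x ≤ (weakCW A B).toReal • (B *ᵥ x) →
        (∀ j, y j = 0 → x j = 0) → ∀ j, y j ≠ 0 → x j ≠ 0 := by
  refine and_congr_right fun _ => ⟨fun hmin x hx hx0 hle hsub j hj hxj => ?_, ?_⟩
  · refine hmin ⟨x, (h.isWeaklyOptimal_iff hm).2 ⟨⟨hx, hx0⟩, hle⟩, ?_⟩
    have hsub' : Function.support x ⊆ Function.support y := fun k hk e => hk (hsub k e)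
    rw [Set.ssubset_iff_of_subset hsub']
    exact ⟨j, hj, fun hj' => hj' hxj⟩
  · rintro H ⟨x, hx, hlt⟩
    obtain ⟨⟨hx1, hx0⟩, hle⟩ := (h.isWeaklyOptimal_iff hm).1 hx
    obtain ⟨j, hj, hxj⟩ := (Set.ssubset_iff_of_subset hlt.1).1 hlt
    exact H x hx1 hx0 hle (fun k hk => by_contra fun e => hlt.1 e hk) j hj (not_not.1 hxj)

theorem exists_isMinimalWeaklyOptimal (h : IsWNPair A B) (hm : 0 < m) :
    ∃ y, IsMinimalWeaklyOptimal A B y := by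
  obtain ⟨x, hx⟩ := h.exists_isWeaklyOptimal hm
  obtain ⟨s, ⟨y, hy, rfl⟩, hs⟩ := (wellFounded_lt (α := Set (Fin n))).has_min
    (Function.support '' {y | IsWeaklyOptimal A B y}) ⟨_, x, hx, rfl⟩
  exact ⟨y, hy, fun ⟨z, hz, hlt⟩ => hs _ ⟨z, hz, rfl⟩ hlt⟩

theorem IsMinimalWeaklyOptimal.smul (h : IsWNPair A B) (hm : 0 < m)
    (hy : IsMinimalWeaklyOptimal A B y) {c : ℝ} (hc : 0 < c) :
    IsMinimalWeaklyOptimal A B (c • y) := by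
  have hz : ∀ j, (c • y) j = 0 ↔ y j = 0 := fun j => by simp [hc.ne']
  rw [h.isMinimalWeaklyOptimal_iff hm, h.isWeaklyOptimal_iff hm] at hy ⊢
  obtain ⟨⟨⟨hy0, hy1⟩, hle⟩, hmin⟩ := hy
  refine ⟨⟨⟨smul_nonneg hc.le hy0, smul_ne_zero hc.ne' hy1⟩, ?_⟩, ?_⟩
  · rw [Matrix.mulVec_smul, Matrix.mulVec_smul, smul_comm]
    exact smul_le_smul_of_nonneg_left hle hc.le
  · simpa only [hz, ne_eq] using hmin

/-- On a row where By vanishes, the inequality reads Ay ≤ 0, and the terms of Ay are nonnegative. -/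
theorem IsWeaklyOptimal.block_eq_zero (h : IsWNPair A B) (hm : 0 < m)
    (hy : IsWeaklyOptimal A B y) : ∀ i ∈ zeroRows B (supp y), ∀ j ∈ supp y, A i j = 0 := by
  intro i hi j hj
  obtain ⟨⟨hy0, -⟩, hle⟩ := (h.isWeaklyOptimal_iff hm).1 hy
  have h1 := hle i
  rw [Pi.smul_apply, mulVec_eq_zero_of_row (mem_zeroRows.1 hi) (fun _ h => h), smul_zero,
    mulVec_apply] at h1
  have hnn : ∀ k ∈ Finset.univ, 0 ≤ A i k * y k := fun k _ =>
    mul_nonneg (h.nonneg_left i k) (hy0 k)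
  have hz := (Finset.sum_eq_zero_iff_of_nonneg hnn).1
    (le_antisymm h1 (Finset.sum_nonneg hnn)) j (Finset.mem_univ _)
  exact (mul_eq_zero.1 hz).resolve_right (mem_supp.1 hj)

/-- Subtracting a positive multiple of v from y preserves Ay ≤ L By. At the step where a coordinate
of the support vanishes, minimality leaves only the zero vector. If v has no positive coordinate,
use -v. -/
theorem IsMinimalWeaklyOptimal.eq_smul (h : IsWNPair A B) (hm : 0 < m)
    (hy : IsMinimalWeaklyOptimal A B y) {v : Fin n → ℝ} (hv : ∀ j, y j = 0 → v j = 0)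
    (hker : A *ᵥ v = (weakCW A B).toReal • (B *ᵥ v)) : ∃ c : ℝ, v = c • y := by
  obtain ⟨hw, hmin⟩ := (h.isMinimalWeaklyOptimal_iff hm).1 hy
  obtain ⟨⟨hy0, -⟩, hle⟩ := (h.isWeaklyOptimal_iff hm).1 hw
  have main : ∀ v : Fin n → ℝ, (∀ j, y j = 0 → v j = 0) →
      A *ᵥ v = (weakCW A B).toReal • (B *ᵥ v) → (∃ j, 0 < v j) → ∃ c : ℝ, v = c • y := by
    intro v hv hker hpos
    obtain ⟨s, hs, hnn, k, hk, hk0⟩ := exists_sub_smul_nonneg hy0 hv hpos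
    by_cases hne : y - s • v = 0
    · refine ⟨s⁻¹, ?_⟩
      rw [sub_eq_zero.1 hne, smul_smul, inv_mul_cancel₀ hs.ne', one_smul]
    · refine absurd hk0 (hmin _ hnn hne ?_ (fun j hj => by simp [hj, hv j hj]) k hk)
      rw [Matrix.mulVec_sub, Matrix.mulVec_sub, Matrix.mulVec_smul, Matrix.mulVec_smul, hker,
        smul_sub, smul_comm s]
      exact sub_le_sub_right hle _
  by_cases hpos : ∃ j, 0 < v j
  · exact main v hv hker hpos
  by_cases hneg : ∃ j, 0 < (-v) j
  · obtain ⟨c, hc⟩ := main (-v) (fun j hj => by simp [hv j hj])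
      (by rw [Matrix.mulVec_neg, Matrix.mulVec_neg, hker, smul_neg]) hneg
    exact ⟨-c, by rw [neg_smul, ← hc, neg_neg]⟩
  · refine ⟨0, funext fun j => ?_⟩
    push Not at hpos hneg
    have h1 := hneg j
    rw [Pi.neg_apply, neg_nonpos] at h1
    simpa using le_antisymm (hpos j) h1

/-- For small s > 0 the vector y + su stays nonnegative and makes every active row strict, while Ax
vanishes on the remaining rows; such a vector would beat L. -/
theorem IsWeaklyOptimal.not_strict_direction (h : IsWNPair A B) (hm : 0 < m)
    (hy : IsWeaklyOptimal A B y) {u : Fin n → ℝ} (hu : ∀ j, y j = 0 → u j = 0)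
    (hlt : ∀ i, i ∉ zeroRows B (supp y) →
      (A *ᵥ u) i < (weakCW A B).toReal * (B *ᵥ u) i) : False := by
  have hzero := hy.block_eq_zero h hm
  obtain ⟨⟨hy0, hy1⟩, hle⟩ := (h.isWeaklyOptimal_iff hm).1 hy
  obtain ⟨s, hs, hnn⟩ : ∃ s : ℝ, 0 < s ∧ 0 ≤ y + s • u := by
    by_cases hpos : ∃ j, 0 < (-u) j
    · obtain ⟨s, hs, hnn, -⟩ :=
        exists_sub_smul_nonneg hy0 (fun j hj => by simp [hu j hj]) hpos
      exact ⟨s, hs, by simpa using hnn⟩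
    · refine ⟨1, one_pos, fun j => ?_⟩
      push Not at hpos
      have h1 := hpos j
      rw [Pi.neg_apply, neg_nonpos] at h1
      simpa using add_nonneg (hy0 j) h1
  have hstrict : ∀ i, i ∉ zeroRows B (supp y) →
      (A *ᵥ (y + s • u)) i < (weakCW A B).toReal * (B *ᵥ (y + s • u)) i := by
    intro i hi
    have h1 := hle i
    have h2 := mul_lt_mul_of_pos_left (hlt i hi) hs
    simp only [Matrix.mulVec_add, Matrix.mulVec_smul, Pi.add_apply, Pi.smul_apply,
      smul_eq_mul] at h1 ⊢
    linarith
  refine h.not_strict hm hnn (fun i => ?_) ?_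
  · by_cases hi : i ∈ zeroRows B (supp y)
    · exact Or.inr (mulVec_eq_zero_of_row (hzero i hi) fun j hj => by simp [hj, hu j hj])
    · exact Or.inl (hstrict i hi)
  · obtain ⟨j, hj⟩ := Function.ne_iff.1 hy1
    obtain ⟨i, hi, -⟩ := h.exists_mulVec_pos hy0 hj
    exact ⟨i, hstrict i fun hmem => hi.ne' (mem_zeroRows.1 hmem j (mem_supp.2 hj))⟩

/-- A minimal weakly optimal vector solves `A y = ρ̂(A,B) B y`, and its support meets as many rows
of `B` as it has elements. -/
theorem IsMinimalWeaklyOptimal.mulVec_eq_and_card (h : IsWNPair A B) (hm : 0 < m)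
    (hy : IsMinimalWeaklyOptimal A B y) :
    A *ᵥ y = (weakCW A B).toReal • (B *ᵥ y) ∧
      (zeroRows B (supp y)).card + (supp y).card = m := by
  obtain ⟨σ, hσ, hσ'⟩ := h.exists_row
  set L := (weakCW A B).toReal
  have hzero := hy.1.block_eq_zero h hm
  let E : (supp y → ℝ) →ₗ[ℝ] (Fin n → ℝ) := Function.ExtendByZero.linearMap ℝ Subtype.val
  have hE : ∀ v (j : supp y), E v j = v j := fun v j =>
    Subtype.val_injective.extend_apply v 0 j
  have hE0 : ∀ v j, y j = 0 → E v j = 0 := fun v j hj =>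
    Function.extend_apply' (f := (Subtype.val : supp y → Fin n)) v 0 j
      (by rintro ⟨a, rfl⟩; exact mem_supp.1 a.2 hj)
  -- The restriction of A - LB to active rows and supported columns; the other rows vanish
  -- identically on these vectors, so nothing is lost.
  let g : (supp y → ℝ) →ₗ[ℝ] (((zeroRows B (supp y))ᶜ : Finset (Fin m)) → ℝ) :=
    (LinearMap.funLeft ℝ ℝ Subtype.val).comp ((A - L • B).mulVecLin.comp E)
  have hg : ∀ v i, g v i = (A *ᵥ E v) i - L * (B *ᵥ E v) i := fun v i => by
    simp [g, LinearMap.funLeft_apply]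
  have hker : ∀ v, g v = 0 → A *ᵥ E v = L • (B *ᵥ E v) := by
    intro v hv
    funext i
    by_cases hi : i ∈ zeroRows B (supp y)
    · rw [Pi.smul_apply, mulVec_eq_zero_of_row (hzero i hi) (hE0 v),
        mulVec_eq_zero_of_row (mem_zeroRows.1 hi) (hE0 v), smul_zero]
    · have h1 := hg v ⟨i, Finset.mem_compl.2 hi⟩
      rw [hv, Pi.zero_apply] at h1
      exact sub_eq_zero.1 h1.symm
  have hrange : LinearMap.range g ≠ ⊤ := by
    intro htop
    obtain ⟨v, hv⟩ := LinearMap.range_eq_top.1 htop fun _ => -1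
    refine hy.1.not_strict_direction h hm (hE0 v) fun i hi => ?_
    have h1 := hg v ⟨i, Finset.mem_compl.2 hi⟩
    rw [hv] at h1
    linarith
  have hr := Submodule.finrank_lt hrange
  rw [Module.finrank_pi, Fintype.card_coe] at hr
  have hST : ((zeroRows B (supp y))ᶜ).card ≤ (supp y).card := by
    rw [compl_zeroRows hσ hσ']
    exact Finset.card_image_le
  have hrn := LinearMap.finrank_range_add_finrank_ker g
  rw [Module.finrank_pi, Fintype.card_coe] at hrn
  have hspan : LinearMap.ker g ≤ Submodule.span ℝ {fun j : supp y => y j} := by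
    intro v hv
    obtain ⟨c, hc⟩ := hy.eq_smul h hm (hE0 v) (hker v hv)
    refine Submodule.mem_span_singleton.2 ⟨c, funext fun j => ?_⟩
    rw [← hE v j, hc]
    rfl
  have hk1 : Module.finrank ℝ (LinearMap.ker g) ≤ 1 :=
    (Submodule.finrank_mono hspan).trans ((finrank_span_le_card _).trans (by simp))
  have hcard : (zeroRows B (supp y)).card + ((zeroRows B (supp y))ᶜ).card = m := by
    rw [Finset.card_add_card_compl, Fintype.card_fin]
  -- With S and T the active rows and the support: rank g < |S| and dim ker g ≤ 1 give |T| ≤ |S|,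
  -- and |S| ≤ |T| was shown above.
  refine ⟨?_, by omega⟩
  -- A trivial kernel would give rank g = |T| ≥ |S|, against rank g < |S|.
  have hne : LinearMap.ker g ≠ ⊥ := by
    intro e
    rw [e, finrank_bot] at hrn
    omega
  obtain ⟨v, hv, hv0⟩ := (Submodule.ne_bot_iff _).1 hne
  have hAv := hker v hv
  obtain ⟨c, hc⟩ := hy.eq_smul h hm (hE0 v) hAv
  have hc0 : c ≠ 0 := by
    rintro rfl
    refine hv0 (funext fun j => ?_)
    rw [← hE v j, hc]
    simp
  rw [hc, Matrix.mulVec_smul, Matrix.mulVec_smul, smul_comm] at hAv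
  exact smul_right_injective _ hc0 hAv

theorem IsMinimalWeaklyOptimal.isExtremal (h : IsWNPair A B) (hm : 0 < m)
    (hy : IsMinimalWeaklyOptimal A B y) (hys : y ∈ stdSimplex ℝ (Fin n)) :
    IsExtremal A B y := by
  classical
  obtain ⟨σ, hσ, hσ'⟩ := h.exists_row
  obtain ⟨heq, hcard⟩ := hy.mulVec_eq_and_card h hm
  have hzero := hy.1.block_eq_zero h hm
  have hmin := ((h.isMinimalWeaklyOptimal_iff hm).1 hy).2
  have hinj := injOn_of_card_eq hσ hσ' hcard
  set L := (weakCW A B).toReal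
  have hy0 : 0 ≤ y := hys.1
  have hypos : ∀ j : supp y, 0 < y j := fun j =>
    lt_of_le_of_ne (hy0 j) (Ne.symm (mem_supp.1 j.2))
  have hne : Nonempty (supp y) := by
    obtain ⟨j, hj⟩ := Function.ne_iff.1 hy.1.1.2
    exact ⟨⟨j, mem_supp.2 hj⟩⟩
  have hCnn : ∀ a b, 0 ≤ cMatrix A B y a b := fun a b => by
    rw [cMatrix_apply hσ hσ' hinj]
    exact mul_nonneg (inv_nonneg.2 (hσ _).le) (h.nonneg_left _ _)
  have hC : cMatrix A B y *ᵥ (fun j => y j) = L • fun j : supp y => y j := by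
    funext j
    rw [cMatrix_mulVec_apply hσ hσ' hinj fun _ h => h, heq, Pi.smul_apply,
      mulVec_apply_of_injOn hσ' hinj (fun _ h => h) j.2, Pi.smul_apply, smul_eq_mul, smul_eq_mul,
      mul_left_comm, ← mul_assoc (_⁻¹), inv_mul_cancel₀ (hσ _).ne', one_mul]
  have hL0 : 0 ≤ L := ENNReal.toReal_nonneg
  refine ⟨hys, by omega, hcard, ?_, isIrred_iff.2 ⟨hCnn, fun Z ⟨a, ha⟩ hZ => ?_⟩, ⟨?_, ?_⟩, ?_⟩
  · ext i j
    exact hzero i i.2 j j.2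
  · by_contra hZne
    obtain ⟨b, hb⟩ := (Set.ne_univ_iff_exists_notMem Z).1 hZne
    -- Set y to zero on Z. In rows belonging to Z both sides become 0, as Z is closed under
    -- successors; in the other active rows Bx = By and Ax ≤ Ay. So x is weakly optimal with smaller
    -- support.
    let x : Fin n → ℝ := fun j => if ∃ z : supp y, z ∈ Z ∧ (z : Fin n) = j then 0 else y j
    have hxy : ∀ j, x j ≤ y j := fun j => by
      by_cases hj : ∃ z : supp y, z ∈ Z ∧ (z : Fin n) = j
      · simpa only [x, hj, if_true, Pi.zero_apply] using hy0 j
      · simp only [x, hj, if_false, le_refl]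
    have hx0 : 0 ≤ x := fun j => by
      by_cases hj : ∃ z : supp y, z ∈ Z ∧ (z : Fin n) = j
      · simp only [x, hj, if_true, Pi.zero_apply, le_refl]
      · simpa only [x, hj, if_false] using hy0 j
    have hxZ : ∀ z : supp y, z ∈ Z → x z = 0 := fun z hz => if_pos ⟨z, hz, rfl⟩
    have hxN : ∀ z : supp y, z ∉ Z → x z = y z := fun z hz =>
      if_neg fun ⟨z', hz', e⟩ => hz (Subtype.ext e ▸ hz')
    have hsub : ∀ j, y j = 0 → x j = 0 := fun j hj =>
      le_antisymm ((hxy j).trans_eq hj) (hx0 j)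
    have hxne : x ≠ 0 := fun e => (hypos b).ne' ((hxN b hb).symm.trans (congrFun e b))
    refine hmin x hx0 hxne (fun i => ?_) hsub a (hypos a).ne' (hxZ a ha)
    by_cases hi : i ∈ zeroRows B (supp y)
    · rw [Pi.smul_apply, mulVec_eq_zero_of_row (hzero i hi) hsub,
        mulVec_eq_zero_of_row (mem_zeroRows.1 hi) hsub, smul_zero]
    · obtain ⟨j, hj, rfl⟩ :=
        Finset.mem_image.1 (compl_zeroRows hσ hσ' (supp y) ▸ Finset.mem_compl.2 hi)
      rw [Pi.smul_apply, smul_eq_mul, mulVec_apply_of_injOn hσ' hinj hsub hj]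
      by_cases hjZ : (⟨j, hj⟩ : supp y) ∈ Z
      · rw [hxZ _ hjZ, mul_zero, mul_zero, mulVec_apply]
        refine (Finset.sum_eq_zero fun k _ => ?_).le
        by_cases hk : y k = 0
        · rw [hsub k hk, mul_zero]
        by_cases hA : A (σ j) k = 0
        · rw [hA, zero_mul]
        · have hkZ := hZ _ hjZ ⟨k, mem_supp.2 hk⟩ (by
            rw [cMatrix_apply hσ hσ' hinj]
            exact mul_pos (inv_pos.2 (hσ j))
              (lt_of_le_of_ne (h.nonneg_left _ _) (Ne.symm hA)))
          rw [hxZ _ hkZ, mul_zero]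
      · rw [hxN _ hjZ]
        have h1 := congrFun heq (σ j)
        rw [Pi.smul_apply, smul_eq_mul, mulVec_apply_of_injOn hσ' hinj (fun _ h => h) hj] at h1
        rw [← h1, mulVec_apply, mulVec_apply]
        exact Finset.sum_le_sum fun k _ => mul_le_mul_of_nonneg_left (hxy k) (h.nonneg_left _ _)
  · exact fun j => hy0 j
  · exact fun e => (hypos hne.some).ne' (congrFun e _)
  · rw [specRad_eq_of_pos_eigenvector hCnn hypos hL0 hC, ENNReal.toReal_ofReal hL0]
    exact hC

/-- Every weakly optimal vector in `E(A,B)` is minimal. -/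
theorem IsExtremal.isMinimalWeaklyOptimal (h : IsWNPair A B) (hm : 0 < m)
    (hy : IsExtremal A B y) (hw : IsWeaklyOptimal A B y) : IsMinimalWeaklyOptimal A B y :=
  (h.isMinimalWeaklyOptimal_iff hm).2
    ⟨hw, fun _ hx hx0 hle hsub _ hj => hy.ne_zero_of_mulVec_le h hx hx0 hsub hle hj⟩

theorem exists_isMinimalWeaklyOptimal_mem_extremalSet (h : IsWNPair A B) (hm : 0 < m) :
    ∃ w ∈ extremalSet A B, IsMinimalWeaklyOptimal A B w := by
  obtain ⟨y, hy⟩ := exists_isMinimalWeaklyOptimal h hm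
  obtain ⟨hy0, hy1⟩ := hy.1.1
  have hs : 0 < ∑ j, y j := by
    obtain ⟨j, hj⟩ := Function.ne_iff.1 hy1
    exact Finset.sum_pos' (fun j _ => hy0 j)
      ⟨j, Finset.mem_univ j, lt_of_le_of_ne (hy0 j) (Ne.symm hj)⟩
  have hmin := hy.smul h hm (inv_pos.2 hs)
  refine ⟨_, hmin.isExtremal h hm ⟨hmin.1.1.1, ?_⟩, hmin⟩
  simp [← Finset.mul_sum, inv_mul_cancel₀ hs.ne']

end Minimal

end CollatzWielandt

theorem mainTheorem4 (m n : ℕ) (hm : 0 < m) (A B : Matrix (Fin m) (Fin n) ℝ)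
    (hAB : IsWNPair A B) :
    (extremalSet A B).Finite ∧
    (∀ w ∈ extremalSet A B,
      IsMonomial (activeBlock B B w) ∧
      specRad (cMatrix A B w) = cwQuotient A B w ∧
      A *ᵥ w = (specRad (cMatrix A B w)).toReal • (B *ᵥ w)) ∧
    IsLeast (cwQuotient A B '' extremalSet A B) (weakCW A B) ∧
    (∀ y ∈ stdSimplex ℝ (Fin n),
      IsMinimalWeaklyOptimal A B y ↔
        y ∈ extremalSet A B ∧ IsMinOn (cwQuotient A B) (extremalSet A B) y) ∧
    (∀ y : Fin n → ℝ, IsMinimalWeaklyOptimal A B y → IsWeakGPFEigenvector A B y) := by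
  -- This w₀ attains the minimum in (c), and comparison with it makes any minimizer over E(A,B)
  -- weakly optimal in (d).
  obtain ⟨w₀, hw₀, hmin₀⟩ := exists_isMinimalWeaklyOptimal_mem_extremalSet hAB hm
  have hlow : ∀ w ∈ extremalSet A B, weakCW A B ≤ cwQuotient A B w := fun w hw =>
    weakCW_le hw.mem_simplex.1 (IsExtremal.ne_zero hw)
  refine ⟨finite_extremalSet hAB, fun w hw => ⟨?_, IsExtremal.specRad_eq hAB hw,
    IsExtremal.mulVec_eq hAB hw⟩, ⟨⟨w₀, hw₀, hmin₀.1.2⟩, ?_⟩, fun y hy => ⟨fun hmin => ?_, ?_⟩,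
    fun y hy => ⟨hy.1.1, hAB.weakCW_ne_top hm, (hy.mulVec_eq_and_card hAB hm).1⟩⟩
  · obtain ⟨σ, hσ, hσ'⟩ := hAB.exists_row
    exact isMonomial_activeBlock hσ hσ' hAB.nonneg_right (IsExtremal.injOn hσ hσ' hw)
  · rintro _ ⟨w, hw, rfl⟩
    exact hlow w hw
  · exact ⟨hmin.isExtremal hAB hm hy, fun w hw => hmin.1.2.le.trans (hlow w hw)⟩
  · rintro ⟨hyE, hyMin⟩
    refine IsExtremal.isMinimalWeaklyOptimal hAB hm hyE
      ⟨⟨hy.1, IsExtremal.ne_zero hyE⟩, le_antisymm ?_ (hlow y hyE)⟩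
    exact (hyMin hw₀).trans hmin₀.1.2.le
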